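/- Let $A$ and $B$ be associative rings with identity, let $U$ be a (unital) $(B,A)$-bimodule, and let $T=\begin{pmatrix} A & 0\\ U & B\end{pmatrix}$ be the corresponding triangular matrix ring, that is, the ring of formal lower triangular matrices $\begin{pmatrix} a & 0\\ u & b\end{pmatrix}$ ($a\in A$, $u\in U$, $b\in B$) with the usual matrix addition and multiplication. Call a ring Gorenstein if it is left and right noetherian and has finite injective dimension both as a left module and as a right module over itself. Suppose that $U$ is finitely generated and of finite projective dimension as a right $A$-module, and also finitely generated and of finite projective dimension as a left $B$-module. Then $T$ is Gorenstein if and only if both $A$ and $B$ are Gorenstein. -/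

import Mathlib

open CategoryTheory
open scoped MulOpposite

universe u

/-- The triangular matrix ring `T = [[A, 0], [U, B]]` of a `(B, A)`-bimodule `U`: its elements are
the formal lower triangular matrices with rows `(a, 0)` and `(u, b)`. -/
@[ext]
structure TriangularMatrixRing (A B U : Type u) where
  /-- the upper left entry -/
  a : A
  /-- the lower left entry -/
  u : U
  /-- the lower right entry -/
  b : B

namespace TriangularMatrixRing

variable {A B U : Type u} [Ring A] [Ring B] [AddCommGroup U]

instance : Zero (TriangularMatrixRing A B U) := ⟨⟨0, 0, 0⟩⟩
instance : One (TriangularMatrixRing A B U) := ⟨⟨1, 0, 1⟩⟩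
instance : Add (TriangularMatrixRing A B U) := ⟨fun x y => ⟨x.a + y.a, x.u + y.u, x.b + y.b⟩⟩
instance : Neg (TriangularMatrixRing A B U) := ⟨fun x => ⟨-x.a, -x.u, -x.b⟩⟩

@[simp] theorem zero_a : (0 : TriangularMatrixRing A B U).a = 0 := rfl
@[simp] theorem zero_u : (0 : TriangularMatrixRing A B U).u = 0 := rfl
@[simp] theorem zero_b : (0 : TriangularMatrixRing A B U).b = 0 := rfl
@[simp] theorem one_a : (1 : TriangularMatrixRing A B U).a = 1 := rfl
@[simp] theorem one_u : (1 : TriangularMatrixRing A B U).u = 0 := rfl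
@[simp] theorem one_b : (1 : TriangularMatrixRing A B U).b = 1 := rfl
@[simp] theorem add_a (x y : TriangularMatrixRing A B U) : (x + y).a = x.a + y.a := rfl
@[simp] theorem add_u (x y : TriangularMatrixRing A B U) : (x + y).u = x.u + y.u := rfl
@[simp] theorem add_b (x y : TriangularMatrixRing A B U) : (x + y).b = x.b + y.b := rfl
@[simp] theorem neg_a (x : TriangularMatrixRing A B U) : (-x).a = -x.a := rfl
@[simp] theorem neg_u (x : TriangularMatrixRing A B U) : (-x).u = -x.u := rfl
@[simp] theorem neg_b (x : TriangularMatrixRing A B U) : (-x).b = -x.b := rfl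

variable [Module B U] [Module Aᵐᵒᵖ U]

/-- Matrix multiplication; `MulOpposite.op a • u` is the right action `u * a`. -/
instance : Mul (TriangularMatrixRing A B U) :=
  ⟨fun x y => ⟨x.a * y.a, MulOpposite.op y.a • x.u + x.b • y.u, x.b * y.b⟩⟩

@[simp] theorem mul_a (x y : TriangularMatrixRing A B U) : (x * y).a = x.a * y.a := rfl
@[simp] theorem mul_u (x y : TriangularMatrixRing A B U) :
    (x * y).u = MulOpposite.op y.a • x.u + x.b • y.u := rfl
@[simp] theorem mul_b (x y : TriangularMatrixRing A B U) : (x * y).b = x.b * y.b := rfl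

instance [SMulCommClass B Aᵐᵒᵖ U] : Ring (TriangularMatrixRing A B U) where
  add_assoc x y z := by ext <;> simp [add_assoc]
  zero_add x := by ext <;> simp
  add_zero x := by ext <;> simp
  add_comm x y := by ext <;> simp [add_comm]
  neg_add_cancel x := by ext <;> simp
  mul_assoc x y z := by
    ext <;> simp [mul_assoc, mul_smul, add_assoc, smul_comm]
  one_mul x := by ext <;> simp
  mul_one x := by ext <;> simp
  zero_mul x := by ext <;> simp
  mul_zero x := by ext <;> simp
  left_distrib x y z := by
    ext <;> simp [mul_add, add_smul]
    abel
  right_distrib x y z := by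
    ext <;> simp [add_mul, add_smul]
    abel
  nsmul := nsmulRec
  zsmul := zsmulRec

end TriangularMatrixRing

/-- A left `R`-module has finite projective dimension. Right `R`-modules are handled as
modules over `Rᵐᵒᵖ`. -/
def HasFiniteProjectiveDimension (R M : Type u) [Ring R] [AddCommGroup M] [Module R M] : Prop :=
  ∃ n : ℕ, HasProjectiveDimensionLE (ModuleCat.of R M) n

/-- A left `R`-module has finite injective dimension. Right `R`-modules are handled as
modules over `Rᵐᵒᵖ`. -/
def HasFiniteInjectiveDimension (R M : Type u) [Ring R] [AddCommGroup M] [Module R M] : Prop :=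
  ∃ n : ℕ, HasInjectiveDimensionLE (ModuleCat.of R M) n

/-- A Gorenstein ring: a two-sided noetherian ring with finite left and right self-injective
dimensions. Here `R`, as a module over `Rᵐᵒᵖ`, is the right regular module. -/
structure IsGorensteinRing (R : Type u) [Ring R] : Prop where
  noetherian_left : IsNoetherian R R
  noetherian_right : IsNoetherian Rᵐᵒᵖ R
  injectiveDimension_left : HasFiniteInjectiveDimension R R
  injectiveDimension_right : HasFiniteInjectiveDimension Rᵐᵒᵖ R

/-! The right-handed half of the Gorenstein condition is the left-handed half for `Tᵐᵒᵖ`, which is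
again triangular, with corners `Bᵐᵒᵖ` and `Aᵐᵒᵖ`. So only left conditions need proof, and the
substance lies in the injective dimension.

The engine is change of rings along `φ : T → R`. If `R` has finite projective dimension as a right
`T`-module, then `R`-modules of finite injective dimension keep this property over `T`
(`HasFiniteInjectiveDimension.restrictRingHom`). Indeed an injective `R`-module is a retract of some
`Hom_ℤ(R, D)` with `D` divisible, and `Hom_ℤ(-, D)` turns a finite projective resolution of the
right module `R` into a finite injective resolution over `T`.

From `A` and `B` to `T`: use the left module sequence `0 → U × B → T → A → 0`. The engine applies to
`T → A` and `T → B`, since as right `T`-modules `A` is a summand of `T`, and `B` is the quotient of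
`T` by `A × U`. Over `B`, the module `U` has finite injective dimension because it is finite of
finite projective dimension.

From `T` to `A` and `B`: the engine applies to the diagonal inclusion `A × B → T`, over which `A`
and `B` become left summands of `T`. Finite injective dimension then descends along the projections
of `A × B`. -/

/-! ### Finite injective and projective dimension -/

section FiniteDimension

variable {R M N P : Type u} [Ring R] [AddCommGroup M] [AddCommGroup N] [AddCommGroup P]
  [Module R M] [Module R N] [Module R P]

theorem ModuleCat.shortExact_of_linearMap {f : M →ₗ[R] N} {g : N →ₗ[R] P}
    (hf : Function.Injective f) (hfg : Function.Exact f g) (hg : Function.Surjective g) :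
    (ModuleCat.shortComplexOfCompEqZero f g hfg.linearMap_comp_eq_zero).ShortExact :=
  ModuleCat.shortComplex_shortExact _ hfg hf hg

/-- A pair of linear maps with `r ∘ i = id` as a retract in the category of modules. -/
def ModuleCat.retractOfLinearMap (i : M →ₗ[R] N) (r : N →ₗ[R] M) (h : ∀ m, r (i m) = m) :
    Retract (ModuleCat.of R M) (ModuleCat.of R N) where
  i := ModuleCat.ofHom i
  r := ModuleCat.ofHom r
  retract := by ext m; exact h m

theorem Module.hasInjectiveDimensionLE_zero_iff :
    HasInjectiveDimensionLE (ModuleCat.of R M) 0 ↔ Module.Injective R M := by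
  rw [Module.injective_iff_injective_object R M]
  exact injective_iff_hasInjectiveDimensionLT_one.symm

theorem Module.hasProjectiveDimensionLE_zero_iff :
    HasProjectiveDimensionLE (ModuleCat.of R M) 0 ↔ Module.Projective R M := by
  rw [IsProjective.iff_projective M]
  exact (projective_iff_hasProjectiveDimensionLE_zero _).symm

variable (R M) in
theorem Module.exists_injective_embedding :
    ∃ (E : Type u) (_ : AddCommGroup E) (_ : Module R E) (f : M →ₗ[R] E),
      Module.Injective R E ∧ Function.Injective f := by
  obtain ⟨I, _, f, _⟩ := (EnoughInjectives.presentation (ModuleCat.of R M)).some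
  exact ⟨I, _, _, f.hom, Module.injective_module_of_injective_object R I,
    (ModuleCat.mono_iff_injective f).mp ‹_›⟩

namespace HasFiniteInjectiveDimension

theorem of_injective [Module.Injective R M] : HasFiniteInjectiveDimension R M :=
  ⟨0, Module.hasInjectiveDimensionLE_zero_iff.2 ‹_›⟩

theorem of_retract (i : M →ₗ[R] N) (r : N →ₗ[R] M) (h : ∀ m, r (i m) = m) :
    HasFiniteInjectiveDimension R N → HasFiniteInjectiveDimension R M := by
  rintro ⟨n, hn⟩
  exact ⟨n, (ModuleCat.retractOfLinearMap i r h).hasInjectiveDimensionLT _⟩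

theorem left_of_exact {f : M →ₗ[R] N} {g : N →ₗ[R] P} (hf : Function.Injective f)
    (hfg : Function.Exact f g) (hg : Function.Surjective g)
    (hN : HasFiniteInjectiveDimension R N) (hP : HasFiniteInjectiveDimension R P) :
    HasFiniteInjectiveDimension R M := by
  obtain ⟨n, hn⟩ := hN
  obtain ⟨p, hp⟩ := hP
  -- The sharp bound is `max n (p + 1)`; the sum is a crude majorant, as only finiteness matters.
  exact ⟨n + p + 1, (ModuleCat.shortExact_of_linearMap hf hfg hg).hasInjectiveDimensionLT_X₁
    (n + p + 1) (hasInjectiveDimensionLT_of_ge (ModuleCat.of R P) (p + 1) _ (by lia))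
    (hasInjectiveDimensionLT_of_ge (ModuleCat.of R N) (n + 1) _ (by lia))⟩

theorem middle_of_exact {f : M →ₗ[R] N} {g : N →ₗ[R] P} (hf : Function.Injective f)
    (hfg : Function.Exact f g) (hg : Function.Surjective g)
    (hM : HasFiniteInjectiveDimension R M) (hP : HasFiniteInjectiveDimension R P) :
    HasFiniteInjectiveDimension R N := by
  obtain ⟨n, hn⟩ := hM
  obtain ⟨p, hp⟩ := hP
  exact ⟨n + p, (ModuleCat.shortExact_of_linearMap hf hfg hg).hasInjectiveDimensionLT_X₂
    (n + p + 1) (hasInjectiveDimensionLT_of_ge (ModuleCat.of R M) (n + 1) _ (by lia))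
    (hasInjectiveDimensionLT_of_ge (ModuleCat.of R P) (p + 1) _ (by lia))⟩

theorem right_of_exact {f : M →ₗ[R] N} {g : N →ₗ[R] P} (hf : Function.Injective f)
    (hfg : Function.Exact f g) (hg : Function.Surjective g)
    (hM : HasFiniteInjectiveDimension R M) (hN : HasFiniteInjectiveDimension R N) :
    HasFiniteInjectiveDimension R P := by
  obtain ⟨m, hm⟩ := hM
  obtain ⟨n, hn⟩ := hN
  exact ⟨n + m, (ModuleCat.shortExact_of_linearMap hf hfg hg).hasInjectiveDimensionLT_X₃
    (n + m + 1) (hasInjectiveDimensionLT_of_ge (ModuleCat.of R N) (n + 1) _ (by lia))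
    (hasInjectiveDimensionLT_of_ge (ModuleCat.of R M) (m + 1) _ (by lia))⟩

theorem prod (hM : HasFiniteInjectiveDimension R M) (hN : HasFiniteInjectiveDimension R N) :
    HasFiniteInjectiveDimension R (M × N) :=
  middle_of_exact (f := LinearMap.inl R M N) (g := LinearMap.snd R M N)
    LinearMap.inl_injective .inl_snd LinearMap.snd_surjective hM hN

theorem of_subsingleton [Subsingleton M] : HasFiniteInjectiveDimension R M :=
  have : Module.Injective R M := ⟨fun _ _ _ _ _ _ _ _ _ => ⟨0, fun _ => Subsingleton.elim _ _⟩⟩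
  of_injective

theorem fin_fun (hM : HasFiniteInjectiveDimension R M) :
    ∀ n : ℕ, HasFiniteInjectiveDimension R (Fin n → M)
  | 0 => of_subsingleton
  | n + 1 => of_retract (Fin.consLinearEquiv R fun _ : Fin (n + 1) => M).symm.toLinearMap
      (Fin.consLinearEquiv R fun _ : Fin (n + 1) => M).toLinearMap
      (LinearEquiv.apply_symm_apply _)
      (hM.prod (fin_fun hM n))

/-- Induction along an injective resolution. -/
theorem induction
    {motive : ∀ (M : Type u) [AddCommGroup M] [Module R M], Prop}
    (injective : ∀ (M : Type u) [AddCommGroup M] [Module R M] [Module.Injective R M], motive M)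
    (left : ∀ (M E C : Type u) [AddCommGroup M] [Module R M] [AddCommGroup E] [Module R E]
      [AddCommGroup C] [Module R C] [Module.Injective R E] (f : M →ₗ[R] E) (g : E →ₗ[R] C),
      Function.Injective f → Function.Exact f g → Function.Surjective g → motive C → motive M)
    (h : HasFiniteInjectiveDimension R M) : motive M := by
  obtain ⟨n, hn⟩ := h
  induction n generalizing M with
  | zero =>
    have := Module.hasInjectiveDimensionLE_zero_iff.1 hn
    exact injective M
  | succ n ih =>
    obtain ⟨E, _, _, f, hE, hf⟩ := Module.exists_injective_embedding R M
    refine left M E (E ⧸ LinearMap.range f) f (LinearMap.range f).mkQ hf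
      f.exact_map_mkQ_range (Submodule.mkQ_surjective _) (ih ?_)
    have hE' : Injective (ModuleCat.of R E) := (Module.injective_iff_injective_object R E).1 hE
    exact ((ModuleCat.shortExact_of_linearMap hf f.exact_map_mkQ_range
      (Submodule.mkQ_surjective _)).hasInjectiveDimensionLT_X₃_iff n hE').2 hn

attribute [local instance] RingHomInvPair.of_ringEquiv in
theorem of_semilinear {S N : Type u} [Ring S] [AddCommGroup N] [Module S N] (e : R ≃+* S)
    (f : M ≃+ N) (hf : ∀ r m, f (r • m) = e r • f m) (h : HasFiniteInjectiveDimension R M) :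
    HasFiniteInjectiveDimension S N := by
  obtain ⟨n, hn⟩ := h
  let f' : ModuleCat.of R M ≃ₛₗ[RingHomClass.toRingHom e] ModuleCat.of S N :=
    { f with map_smul' := hf }
  exact ⟨n, (ModuleCat.hasInjectiveDimensionLE_iff_of_semiLinearEquiv e f' n).1 hn⟩

end HasFiniteInjectiveDimension

namespace HasFiniteProjectiveDimension

theorem of_projective [Module.Projective R M] : HasFiniteProjectiveDimension R M :=
  ⟨0, Module.hasProjectiveDimensionLE_zero_iff.2 ‹_›⟩

theorem of_retract (i : M →ₗ[R] N) (r : N →ₗ[R] M) (h : ∀ m, r (i m) = m) :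
    HasFiniteProjectiveDimension R N → HasFiniteProjectiveDimension R M := by
  rintro ⟨n, hn⟩
  exact ⟨n, (ModuleCat.retractOfLinearMap i r h).hasProjectiveDimensionLT _⟩

theorem middle_of_exact {f : M →ₗ[R] N} {g : N →ₗ[R] P} (hf : Function.Injective f)
    (hfg : Function.Exact f g) (hg : Function.Surjective g)
    (hM : HasFiniteProjectiveDimension R M) (hP : HasFiniteProjectiveDimension R P) :
    HasFiniteProjectiveDimension R N := by
  obtain ⟨n, hn⟩ := hM
  obtain ⟨p, hp⟩ := hP
  exact ⟨n + p, (ModuleCat.shortExact_of_linearMap hf hfg hg).hasProjectiveDimensionLT_X₂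
    (n + p + 1) (hasProjectiveDimensionLT_of_ge (ModuleCat.of R M) (n + 1) _ (by lia))
    (hasProjectiveDimensionLT_of_ge (ModuleCat.of R P) (p + 1) _ (by lia))⟩

theorem right_of_exact {f : M →ₗ[R] N} {g : N →ₗ[R] P} (hf : Function.Injective f)
    (hfg : Function.Exact f g) (hg : Function.Surjective g)
    (hM : HasFiniteProjectiveDimension R M) (hN : HasFiniteProjectiveDimension R N) :
    HasFiniteProjectiveDimension R P := by
  obtain ⟨m, hm⟩ := hM
  obtain ⟨n, hn⟩ := hN
  exact ⟨n + m + 1, (ModuleCat.shortExact_of_linearMap hf hfg hg).hasProjectiveDimensionLT_X₃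
    (n + m + 1) (hasProjectiveDimensionLT_of_ge (ModuleCat.of R M) (m + 1) _ (by lia))
    (hasProjectiveDimensionLT_of_ge (ModuleCat.of R N) (n + 1) _ (by lia))⟩

theorem prod (hM : HasFiniteProjectiveDimension R M) (hN : HasFiniteProjectiveDimension R N) :
    HasFiniteProjectiveDimension R (M × N) :=
  middle_of_exact (f := LinearMap.inl R M N) (g := LinearMap.snd R M N)
    LinearMap.inl_injective .inl_snd LinearMap.snd_surjective hM hN

/-- Induction along a free resolution. -/
theorem induction
    {motive : ∀ (M : Type u) [AddCommGroup M] [Module R M], Prop}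
    (projective : ∀ (M : Type u) [AddCommGroup M] [Module R M] [Module.Projective R M], motive M)
    (right : ∀ (K F M : Type u) [AddCommGroup K] [Module R K] [AddCommGroup F] [Module R F]
      [AddCommGroup M] [Module R M] [Module.Projective R F] (f : K →ₗ[R] F) (g : F →ₗ[R] M),
      Function.Injective f → Function.Exact f g → Function.Surjective g → motive K → motive M)
    (h : HasFiniteProjectiveDimension R M) : motive M := by
  obtain ⟨n, hn⟩ := h
  induction n generalizing M with
  | zero =>
    have := Module.hasProjectiveDimensionLE_zero_iff.1 hn
    exact projective M
  | succ n ih =>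
    let g : (M →₀ R) →ₗ[R] M := Finsupp.linearCombination R id
    have hg : Function.Surjective g := Finsupp.linearCombination_id_surjective R M
    refine right (LinearMap.ker g) (M →₀ R) M (LinearMap.ker g).subtype g
      (Submodule.subtype_injective _) g.exact_subtype_ker_map hg (ih ?_)
    have hF : Projective (ModuleCat.of R (M →₀ R)) :=
      (IsProjective.iff_projective (M →₀ R)).1 inferInstance
    exact ((ModuleCat.shortExact_of_linearMap (Submodule.subtype_injective _)
      g.exact_subtype_ker_map hg).hasProjectiveDimensionLT_X₃_iff n hF).1 hn

/-- Induction along a resolution by finite free modules, over a noetherian ring. -/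
theorem induction_finite [IsNoetherianRing R]
    {motive : ∀ (M : Type u) [AddCommGroup M] [Module R M], Prop}
    (projective : ∀ (M : Type u) [AddCommGroup M] [Module R M] [Module.Projective R M]
      [Module.Finite R M], motive M)
    (right : ∀ (K M : Type u) [AddCommGroup K] [Module R K]
      [AddCommGroup M] [Module R M] (n : ℕ) (f : K →ₗ[R] (Fin n → R)) (g : (Fin n → R) →ₗ[R] M),
      Function.Injective f → Function.Exact f g → Function.Surjective g → motive K → motive M)
    [Module.Finite R M] (h : HasFiniteProjectiveDimension R M) : motive M := by
  obtain ⟨n, hn⟩ := h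
  induction n generalizing M with
  | zero =>
    have := Module.hasProjectiveDimensionLE_zero_iff.1 hn
    exact projective M
  | succ n ih =>
    obtain ⟨k, g, hg⟩ := Module.Finite.exists_fin' R M
    -- Noetherianity keeps the kernel finite, so the induction hypothesis applies to it.
    refine right (LinearMap.ker g) M k (LinearMap.ker g).subtype g
      (Submodule.subtype_injective _) g.exact_subtype_ker_map hg (ih ?_)
    have hF : Projective (ModuleCat.of R (Fin k → R)) :=
      (IsProjective.iff_projective (Fin k → R)).1 inferInstance
    exact ((ModuleCat.shortExact_of_linearMap (Submodule.subtype_injective _)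
      g.exact_subtype_ker_map hg).hasProjectiveDimensionLT_X₃_iff n hF).1 hn

attribute [local instance] RingHomInvPair.of_ringEquiv in
theorem of_semilinear {S N : Type u} [Ring S] [AddCommGroup N] [Module S N] (e : R ≃+* S)
    (f : M ≃+ N) (hf : ∀ r m, f (r • m) = e r • f m) (h : HasFiniteProjectiveDimension R M) :
    HasFiniteProjectiveDimension S N := by
  obtain ⟨n, hn⟩ := h
  let f' : ModuleCat.of R M ≃ₛₗ[RingHomClass.toRingHom e] ModuleCat.of S N :=
    { f with map_smul' := hf }
  exact ⟨n, ModuleCat.hasProjectiveDimensionLE_of_semiLinearEquiv e f' n⟩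

end HasFiniteProjectiveDimension

/-- Over a left noetherian ring of finite self-injective dimension, finite modules of finite
projective dimension have finite injective dimension. -/
theorem HasFiniteProjectiveDimension.hasFiniteInjectiveDimension [IsNoetherianRing R]
    [Module.Finite R M] (hR : HasFiniteInjectiveDimension R R)
    (hM : HasFiniteProjectiveDimension R M) : HasFiniteInjectiveDimension R M := by
  refine induction_finite (motive := fun M _ _ => HasFiniteInjectiveDimension R M)
    ?_ ?_ hM
  · intro M _ _ _ _
    obtain ⟨n, g, hg⟩ := Module.Finite.exists_fin' R M
    obtain ⟨s, hs⟩ := g.exists_rightInverse_of_surjective (LinearMap.range_eq_top.2 hg)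
    exact .of_retract s g (fun m => LinearMap.congr_fun hs m) (hR.fin_fun n)
  · intro K M _ _ _ _ n f g hf hfg hg hK
    exact .right_of_exact hf hfg hg hK (hR.fin_fun n)

end FiniteDimension

/-! ### Duals with values in a divisible group -/

/-- The additive maps `P → D`. For a right `R`-module `P` this is a left `R`-module through
the action of `R` on `P`. -/
def AddDual (P D : Type u) [AddCommGroup P] [AddCommGroup D] : Type u := P →+ D

namespace AddDual

variable {R P Q D : Type u} [Ring R] [AddCommGroup P] [AddCommGroup Q] [AddCommGroup D]

instance : AddCommGroup (AddDual P D) := inferInstanceAs (AddCommGroup (P →+ D))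

instance : FunLike (AddDual P D) P D := inferInstanceAs (FunLike (P →+ D) P D)

instance : AddMonoidHomClass (AddDual P D) P D :=
  inferInstanceAs (AddMonoidHomClass (P →+ D) P D)

@[ext] theorem ext {f g : AddDual P D} (h : ∀ p, f p = g p) : f = g := DFunLike.ext _ _ h

@[simp] theorem add_apply (f g : AddDual P D) (p : P) : (f + g) p = f p + g p := rfl

@[simp] theorem zero_apply (p : P) : (0 : AddDual P D) p = 0 := rfl

variable [Module Rᵐᵒᵖ P] [Module Rᵐᵒᵖ Q]

instance : Module R (AddDual P D) where
  smul r f := AddMonoidHom.comp f (DistribSMul.toAddMonoidHom P (MulOpposite.op r))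
  one_smul f := by ext p; exact congrArg f (one_smul _ p)
  mul_smul r s f := by ext p; exact congrArg f (mul_smul (MulOpposite.op s) (MulOpposite.op r) p)
  smul_zero r := rfl
  smul_add r f g := rfl
  add_smul r s f := by
    ext p
    exact (congrArg f (add_smul (MulOpposite.op r) (MulOpposite.op s) p)).trans (map_add f _ _)
  zero_smul f := by ext p; exact (congrArg f (zero_smul Rᵐᵒᵖ p)).trans (map_zero f)

@[simp] theorem smul_apply (r : R) (f : AddDual P D) (p : P) :
    (r • f) p = f (MulOpposite.op r • p) := rfl

variable (D) in
/-- Precomposition with a linear map. -/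
def map (g : P →ₗ[Rᵐᵒᵖ] Q) : AddDual Q D →ₗ[R] AddDual P D where
  toFun f := AddMonoidHom.comp f g.toAddMonoidHom
  map_add' _ _ := rfl
  map_smul' r f := by ext p; exact congrArg f (map_smul g (MulOpposite.op r) p).symm

@[simp] theorem map_apply (g : P →ₗ[Rᵐᵒᵖ] Q) (f : AddDual Q D) (p : P) :
    map D g f p = f (g p) := rfl

/-- Morally, `Hom_R(X, Hom_ℤ(P, D)) = Hom_ℤ(P ⊗ X, D)` is exact in `X`, as `P` is flat and `D` is
injective. The proof avoids tensor products: it solves the extension problem on a free module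
covering `P`, one basis element at a time, and pulls back along a section. -/
theorem injective_of_projective (hD : Module.Baer ℤ D) [Module.Projective Rᵐᵒᵖ P] :
    Module.Injective R (AddDual P D) where
  out X Y _ _ _ _ i hi g := by
    obtain ⟨s, hs⟩ := (Module.projective_def (R := Rᵐᵒᵖ) (P := P)).1 inferInstance
    -- The extensions are chosen independently for each `p`, with no compatibility; freeness of `P
    -- →₀ Rᵐᵒᵖ` makes none necessary.
    have ev : ∀ p : P, ∃ h : Y →+ D, ∀ x, h (i x) = g x p := fun p => by
      obtain ⟨h, hh⟩ := hD.extension_property_addMonoidHom i.toAddMonoidHom hi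
        { toFun := fun x => g x p, map_zero' := by simp, map_add' := by simp }
      exact ⟨h, fun x => DFunLike.congr_fun hh x⟩
    choose h hh using ev
    let k (y : Y) : (P →₀ Rᵐᵒᵖ) →+ D := Finsupp.liftAddHom fun q =>
      { toFun := fun r => h q (r.unop • y)
        map_zero' := by simp
        map_add' := by simp [add_smul] }
    have hk (y : Y) (q : P) (r : Rᵐᵒᵖ) : k y (Finsupp.single q r) = h q (r.unop • y) := by
      simp [k]
    have k_add (y z : Y) : k (y + z) = k y + k z := by
      ext q r; simp [hk]
    have k_smul (r : R) (y : Y) (v : P →₀ Rᵐᵒᵖ) : k (r • y) v = k y (MulOpposite.op r • v) := by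
      induction v using Finsupp.induction_linear with
      | zero => simp
      | add v w hv hw => simp [hv, hw]
      | single q c => rw [Finsupp.smul_single, hk, hk, smul_eq_mul, MulOpposite.unop_mul,
          MulOpposite.unop_op, mul_smul]
    have k_map (x : X) (v : P →₀ Rᵐᵒᵖ) :
        k (i x) v = g x (Finsupp.linearCombination Rᵐᵒᵖ id v) := by
      induction v using Finsupp.induction_linear with
      | zero => simp
      | add v w hv hw => simp [hv, hw]
      | single q c => rw [hk, ← map_smul, hh, map_smul, smul_apply, MulOpposite.op_unop,
          Finsupp.linearCombination_single, id_eq]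
    refine ⟨{ toFun := fun y => (k y).comp s.toAddMonoidHom, map_add' := ?_, map_smul' := ?_ }, ?_⟩
    · intro y z
      ext p
      exact DFunLike.congr_fun (k_add y z) (s p)
    · intro r y
      ext p
      exact (k_smul r y (s p)).trans (congrArg (k y) (map_smul s _ p).symm)
    · intro x
      ext p
      exact (k_map x (s p)).trans (congrArg (g x) (hs p))

/-- `Hom_ℤ(-, D)` is exact and contravariant, so a projective resolution of `P` dualizes to an
injective resolution. -/
theorem hasFiniteInjectiveDimension (hD : Module.Baer ℤ D)
    (hP : HasFiniteProjectiveDimension Rᵐᵒᵖ P) :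
    HasFiniteInjectiveDimension R (AddDual P D) := by
  refine hP.induction (motive := fun P _ _ => HasFiniteInjectiveDimension R (AddDual P D)) ?_ ?_
  · intro P _ _ _
    have : Module.Injective R (AddDual P D) := injective_of_projective hD
    exact .of_injective
  · intro K F P _ _ _ _ _ _ _ f g hf hfg hg hK
    have : Module.Injective R (AddDual F D) := injective_of_projective hD
    refine .left_of_exact (f := map D g) (g := map D f) ?_ ?_ ?_ .of_injective hK
    · intro u v huv
      ext p
      obtain ⟨x, rfl⟩ := hg p
      exact DFunLike.congr_fun huv x
    · intro u
      constructor
      · intro hu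
        have hker : ∀ x, g x = 0 → u x = 0 := fun x hx => by
          obtain ⟨y, rfl⟩ := (hfg x).1 hx
          exact DFunLike.congr_fun hu y
        obtain ⟨s, hs⟩ := hg.hasRightInverse
        have hus : ∀ x, u (s (g x)) = u x := fun x => by
          rw [← sub_eq_zero, ← map_sub]
          exact hker _ (by rw [map_sub, hs, sub_self])
        -- The section `s` is only a function; additivity holds because `u` is constant on the
        -- fibres of `g`.
        refine ⟨AddMonoidHom.mk' (fun p => u (s p)) fun p q => ?_, AddDual.ext hus⟩
        obtain ⟨x, rfl⟩ := hg p
        obtain ⟨y, rfl⟩ := hg q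
        rw [← map_add g, hus, hus, hus, map_add]
      · rintro ⟨v, rfl⟩
        ext y
        simp [hfg.apply_apply_eq_zero]
    · intro u
      obtain ⟨v, hv⟩ := hD.extension_property_addMonoidHom f.toAddMonoidHom hf u
      exact ⟨v, AddDual.ext fun y => DFunLike.congr_fun hv y⟩

end AddDual

/-! ### Injective and projective dimension under change of rings -/

section ChangeOfRings

variable {T R M : Type u} [Ring T] [Ring R] (φ : T →+* R)

/-- Every injective module is a retract of the dual of the ring with values in a divisible group. -/
theorem Module.Injective.exists_retract_addDual (E : Type u) [AddCommGroup E] [Module R E]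
    [Module.Injective R E] : ∃ (D : Type u) (_ : AddCommGroup D) (i : E →ₗ[R] AddDual R D)
      (r : AddDual R D →ₗ[R] E), Module.Baer ℤ D ∧ ∀ x, r (i x) = x := by
  obtain ⟨I, _, f, _⟩ := (EnoughInjectives.presentation (ModuleCat.of ℤ E)).some
  have hf : Function.Injective f.hom := (ModuleCat.mono_iff_injective f).mp ‹_›
  have hI : Module.Injective ℤ I := Module.injective_module_of_injective_object ℤ I
  let i : E →ₗ[R] AddDual R I :=
    { toFun := fun x => f.hom.toAddMonoidHom.comp
        ((LinearMap.toSpanSingleton R E x).toAddMonoidHom)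
      map_add' := fun x y => by
        ext r
        exact (congrArg f.hom (smul_add r x y)).trans (map_add f.hom _ _)
      map_smul' := fun s x => by
        ext r
        exact congrArg f.hom (mul_smul r s x).symm }
  have hi : Function.Injective i := fun x y hxy => by
    have h : f.hom ((1 : R) • x) = f.hom ((1 : R) • y) := DFunLike.congr_fun hxy (1 : R)
    exact hf (by simpa using h)
  obtain ⟨r, hr⟩ := Module.Injective.out i hi LinearMap.id
  refine ⟨I, inferInstance, i, r, ?_, hr⟩
  convert Module.Baer.of_injective hI
  -- The two `ℤ`-module structures on `I` agree, since an abelian group carries only one.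
  exact Subsingleton.elim _ _

/-- A linear map, seen as a linear map of modules with scalars restricted along `φ`. -/
def LinearMap.restrictRingHom {M N : Type u} [AddCommGroup M] [AddCommGroup N] [Module R M]
    [Module R N] [Module T M] [Module T N] (hM : ∀ (t : T) (x : M), t • x = φ t • x)
    (hN : ∀ (t : T) (x : N), t • x = φ t • x) (f : M →ₗ[R] N) : M →ₗ[T] N :=
  { f with map_smul' := fun t x => by simp [hM, hN] }

theorem hasFiniteInjectiveDimension_of_injective_of_ringHom [Module Tᵐᵒᵖ R]
    (hR : ∀ (t : T) (r : R), MulOpposite.op t • r = r * φ t)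
    (hpd : HasFiniteProjectiveDimension Tᵐᵒᵖ R) (E : Type u) [AddCommGroup E] [Module R E]
    [Module T E] (hE : ∀ (t : T) (x : E), t • x = φ t • x) [Module.Injective R E] :
    HasFiniteInjectiveDimension T E := by
  obtain ⟨D, _, i, r, hD, hri⟩ := Module.Injective.exists_retract_addDual (R := R) E
  -- The `T`-action dual to the right action on `R` is the `R`-action restricted along `φ`.
  have hdual (t : T) (f : AddDual R D) : t • f = φ t • f := by
    ext x
    simp [hR]
  exact .of_retract (N := AddDual R D)
    (i.restrictRingHom φ hE hdual) (r.restrictRingHom φ hdual hE) hri (AddDual.hasFiniteInjectiveDimension hD hpd)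

theorem Module.injective_of_ringHom [Module Tᵐᵒᵖ R]
    (hR : ∀ (t : T) (r : R), MulOpposite.op t • r = r * φ t)
    [Module.Projective Tᵐᵒᵖ R] (E : Type u) [AddCommGroup E] [Module R E]
    [Module T E] (hE : ∀ (t : T) (x : E), t • x = φ t • x) [Module.Injective R E] :
    Module.Injective T E := by
  obtain ⟨D, _, i, r, hD, hri⟩ := Module.Injective.exists_retract_addDual (R := R) E
  have hdual (t : T) (f : AddDual R D) : t • f = φ t • f := by
    ext x
    simp [hR]
  have := AddDual.injective_of_projective (R := T) (P := R) hD
  refine ⟨fun X Y _ _ _ _ f hf g => ?_⟩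
  obtain ⟨h, hh⟩ := Module.Injective.out f hf (i.restrictRingHom φ hE hdual ∘ₗ g)
  refine ⟨r.restrictRingHom φ hdual hE ∘ₗ h, fun x => ?_⟩
  exact (congrArg r (hh x)).trans (hri (g x))

theorem HasFiniteInjectiveDimension.restrictRingHom [Module Tᵐᵒᵖ R]
    (hR : ∀ (t : T) (r : R), MulOpposite.op t • r = r * φ t)
    (hpd : HasFiniteProjectiveDimension Tᵐᵒᵖ R) [AddCommGroup M] [Module R M]
    [Module T M] (hM : ∀ (t : T) (x : M), t • x = φ t • x)
    (h : HasFiniteInjectiveDimension R M) : HasFiniteInjectiveDimension T M := by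
  -- The `T`-structure is quantified inside the motive, as each module of the resolution needs its
  -- own.
  refine h.induction (motive := fun M _ _ => ∀ [Module T M],
    (∀ (t : T) (x : M), t • x = φ t • x) → HasFiniteInjectiveDimension T M) ?_ ?_ hM
  · intro E _ _ _ _ hE
    exact hasFiniteInjectiveDimension_of_injective_of_ringHom φ hR hpd E hE
  · intro M E C _ _ _ _ _ _ _ f g hf hfg hg hC _ hM
    let _ : Module T E := Module.compHom E φ
    let _ : Module T C := Module.compHom C φ
    exact .left_of_exact (f := f.restrictRingHom φ hM fun _ _ => rfl)
      (g := g.restrictRingHom φ (fun _ _ => rfl) fun _ _ => rfl) hf hfg hg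
      (hasFiniteInjectiveDimension_of_injective_of_ringHom φ hR hpd E fun _ _ => rfl)
      (hC fun _ _ => rfl)

/-- A projective `R`-module is a retract of a sum of copies of `R`, hence projective over `T`;
projective resolutions therefore restrict. -/
theorem HasFiniteProjectiveDimension.restrictRingHom [Module T R]
    (hR : ∀ (t : T) (r : R), t • r = φ t * r) [Module.Projective T R] [AddCommGroup M] [Module R M]
    [Module T M] (hM : ∀ (t : T) (x : M), t • x = φ t • x)
    (h : HasFiniteProjectiveDimension R M) : HasFiniteProjectiveDimension T M := by
  have key (P : Type u) [AddCommGroup P] [Module R P] [Module T P] [Module.Projective R P]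
      (hP : ∀ (t : T) (x : P), t • x = φ t • x) : Module.Projective T P := by
    obtain ⟨s, hs⟩ := (Module.projective_def' (R := R) (P := P)).1 inferInstance
    have hF (t : T) (x : P →₀ R) : t • x = φ t • x := by
      ext
      simp [hR]
    classical
    have : Module.Projective T (P →₀ R) :=
      .of_equiv' (finsuppLequivDFinsupp (ι := P) (M := R) T).symm
    exact .of_split (s.restrictRingHom φ hP hF)
      ((Finsupp.linearCombination R id).restrictRingHom φ hF hP)
      (LinearMap.ext fun x => LinearMap.congr_fun hs x)
  refine h.induction (motive := fun M _ _ => ∀ [Module T M],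
    (∀ (t : T) (x : M), t • x = φ t • x) → HasFiniteProjectiveDimension T M) ?_ ?_ hM
  · intro P _ _ _ _ hP
    have := key P hP
    exact .of_projective
  · intro K F P _ _ _ _ _ _ _ f g hf hfg hg hK _ hP
    let _ : Module T K := Module.compHom K φ
    let _ : Module T F := Module.compHom F φ
    have := key F fun _ _ => rfl
    exact .right_of_exact (f := f.restrictRingHom φ (fun _ _ => rfl) fun _ _ => rfl)
      (g := g.restrictRingHom φ (fun _ _ => rfl) hP) hf hfg hg
      (hK fun _ _ => rfl) .of_projective

/-- The right `T`-module structure on `R` induced by a ring homomorphism `T → R`. -/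
abbrev RingHom.rightModule : Module Tᵐᵒᵖ R := Module.compHom R φ.op

theorem HasFiniteProjectiveDimension.restrictRingHom_op
    (hpr : letI := φ.rightModule; Module.Projective Tᵐᵒᵖ R) [AddCommGroup M] [Module Rᵐᵒᵖ M]
    [Module Tᵐᵒᵖ M] (hM : ∀ (t : Tᵐᵒᵖ) (x : M), t • x = φ.op t • x)
    (h : HasFiniteProjectiveDimension Rᵐᵒᵖ M) : HasFiniteProjectiveDimension Tᵐᵒᵖ M := by
  let _ := φ.rightModule
  let _ : Module Tᵐᵒᵖ Rᵐᵒᵖ := Module.compHom Rᵐᵒᵖ φ.op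
  have : Module.Projective Tᵐᵒᵖ R := hpr
  have : Module.Projective Tᵐᵒᵖ Rᵐᵒᵖ := .of_equiv' (M := R)
    { MulOpposite.opAddEquiv with map_smul' := fun _ _ => rfl }
  exact h.restrictRingHom φ.op (fun _ _ => rfl) hM

/-- The section makes `R` a direct summand of `T` as a right module. It need not preserve `1`, so
inclusions of corners qualify. -/
theorem Module.Projective.rightModule_of_section (σ : R →+ T) (hφσ : ∀ r, φ (σ r) = r)
    (hσ : ∀ r t, σ (r * φ t) = σ r * t) :
    letI := φ.rightModule; Module.Projective Tᵐᵒᵖ R := by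
  let _ := φ.rightModule
  have : Module.Projective Tᵐᵒᵖ T := .of_equiv' (M := Tᵐᵒᵖ)
    { MulOpposite.opAddEquiv.symm with map_smul' := fun _ _ => rfl }
  exact .of_split (M := T)
    ({ σ with map_smul' := fun t r => hσ r t.unop } : R →ₗ[Tᵐᵒᵖ] T)
    { φ with map_smul' := fun t x => map_mul φ x t.unop } (LinearMap.ext hφσ)

/-- In dimension zero, surjectivity makes `T`-linear maps between `R`-modules `R`-linear.
Projectivity of the right module `R` keeps `R`-injectives injective over `T`, so dimension shifting
runs in parallel over both rings. -/
theorem HasFiniteInjectiveDimension.of_restrictRingHom (hφ : Function.Surjective φ)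
    [Module Tᵐᵒᵖ R] (hR : ∀ (t : T) (r : R), MulOpposite.op t • r = r * φ t)
    [Module.Projective Tᵐᵒᵖ R] [AddCommGroup M] [Module R M]
    [Module T M] (hM : ∀ (t : T) (x : M), t • x = φ t • x)
    (h : HasFiniteInjectiveDimension T M) : HasFiniteInjectiveDimension R M := by
  obtain ⟨n, hn⟩ := h
  refine ⟨n, ?_⟩
  induction n generalizing M with
  | zero =>
    rw [Module.hasInjectiveDimensionLE_zero_iff] at hn ⊢
    refine ⟨fun X Y _ _ _ _ f hf g => ?_⟩
    let _ : Module T X := Module.compHom X φ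
    let _ : Module T Y := Module.compHom Y φ
    obtain ⟨h, hh⟩ := hn.out (f.restrictRingHom φ (fun _ _ => rfl) fun _ _ => rfl) hf
      (g.restrictRingHom φ (fun _ _ => rfl) hM)
    refine ⟨{ h with map_smul' := fun r y => ?_ }, hh⟩
    obtain ⟨t, rfl⟩ := hφ r
    exact (map_smul h t y).trans (hM t _)
  | succ n ih =>
    obtain ⟨E, _, _, f, hE, hf⟩ := Module.exists_injective_embedding R M
    let _ : Module T E := Module.compHom E φ
    let _ : Module T (E ⧸ LinearMap.range f) := Module.compHom _ φ
    have hE' : Injective (ModuleCat.of R E) := (Module.injective_iff_injective_object R E).1 hE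
    have hE'' : Injective (ModuleCat.of T E) := (Module.injective_iff_injective_object T E).1
      (Module.injective_of_ringHom φ hR E fun _ _ => rfl)
    have hfg := f.exact_map_mkQ_range
    have hg := Submodule.mkQ_surjective (LinearMap.range f)
    refine ((ModuleCat.shortExact_of_linearMap hf hfg hg).hasInjectiveDimensionLT_X₃_iff n hE').1
      (ih (fun _ _ => rfl) ?_)
    exact ((ModuleCat.shortExact_of_linearMap (f := f.restrictRingHom φ hM fun _ _ => rfl)
      (g := (LinearMap.range f).mkQ.restrictRingHom φ (fun _ _ => rfl) fun _ _ => rfl)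
      hf hfg hg).hasInjectiveDimensionLT_X₃_iff n hE'').2 hn

end ChangeOfRings

/-- Surjectivity of `φ` makes every `T`-submodule an `R`-submodule. -/
theorem IsNoetherian.of_ringHom {T R M : Type u} [Ring T] [Ring R] [AddCommGroup M] [Module R M]
    [Module T M] (φ : T →+* R) (hφ : Function.Surjective φ)
    (hM : ∀ (t : T) (x : M), t • x = φ t • x) [IsNoetherian R M] : IsNoetherian T M := by
  have : RingHomSurjective φ := ⟨hφ⟩
  let f : M →ₛₗ[φ] M := { AddMonoidHom.id M with map_smul' := hM }
  rw [isNoetherian_iff']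
  exact (Submodule.map_strictMono_of_injective (f := f) fun _ _ h => h).wellFoundedGT

/-! ### Noetherianity and injective dimension of triangular matrix rings -/

namespace TriangularMatrixRing

variable {A B U : Type u} [Ring A] [Ring B] [AddCommGroup U]
  [Module B U] [Module Aᵐᵒᵖ U] [SMulCommClass B Aᵐᵒᵖ U]

variable (A B U) in
/-- The projection to the upper left entry. -/
@[simps]
def fstHom : TriangularMatrixRing A B U →+* A where
  toFun := a
  map_zero' := rfl
  map_one' := rfl
  map_add' _ _ := rfl
  map_mul' _ _ := rfl

variable (A B U) in
/-- The projection to the lower right entry. -/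
@[simps]
def sndHom : TriangularMatrixRing A B U →+* B where
  toFun := b
  map_zero' := rfl
  map_one' := rfl
  map_add' _ _ := rfl
  map_mul' _ _ := rfl

variable (A B U) in
/-- The inclusion of the diagonal matrices. -/
@[simps]
def diagHom : A × B →+* TriangularMatrixRing A B U where
  toFun x := ⟨x.1, 0, x.2⟩
  map_zero' := rfl
  map_one' := rfl
  map_add' _ _ := by ext <;> simp
  map_mul' _ _ := by ext <;> simp

theorem fstHom_surjective : Function.Surjective (fstHom A B U) := fun x => ⟨⟨x, 0, 0⟩, rfl⟩

theorem sndHom_surjective : Function.Surjective (sndHom A B U) := fun x => ⟨⟨0, 0, x⟩, rfl⟩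

variable (A B U) in
-- The matrices `(a, 0, 0)` form a right ideal generated by an idempotent, isomorphic to `A`.
theorem projective_fstHom :
    letI := (fstHom A B U).rightModule
    Module.Projective (TriangularMatrixRing A B U)ᵐᵒᵖ A :=
  .rightModule_of_section (fstHom A B U)
    (AddMonoidHom.mk' (fun x => ⟨x, 0, 0⟩) fun _ _ => by ext <;> simp) (fun _ => rfl)
    fun _ _ => by ext <;> simp

/-- The kernel of `T → B` is `A × U`, on which `T` acts from the right through `A`. As the right
module `A` is projective over `T`, the kernel has finite projective dimension, and hence so does the
quotient `B`. -/
theorem hasFiniteProjectiveDimension_sndHom (hU : HasFiniteProjectiveDimension Aᵐᵒᵖ U) :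
    letI := (sndHom A B U).rightModule
    HasFiniteProjectiveDimension (TriangularMatrixRing A B U)ᵐᵒᵖ B := by
  let _ := (sndHom A B U).rightModule
  let _ : Module (TriangularMatrixRing A B U)ᵐᵒᵖ (A × U) := Module.compHom _ (fstHom A B U).op
  have hA : HasFiniteProjectiveDimension Aᵐᵒᵖ A :=
    have : Module.Projective Aᵐᵒᵖ A := .of_equiv' (M := Aᵐᵒᵖ)
      { MulOpposite.opAddEquiv.symm with map_smul' := fun _ _ => rfl }
    .of_projective
  have hAU : HasFiniteProjectiveDimension (TriangularMatrixRing A B U)ᵐᵒᵖ (A × U) :=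
    (hA.prod hU).restrictRingHom_op _ (projective_fstHom A B U) fun _ _ => rfl
  have hT : HasFiniteProjectiveDimension (TriangularMatrixRing A B U)ᵐᵒᵖ
      (TriangularMatrixRing A B U) :=
    have : Module.Projective (TriangularMatrixRing A B U)ᵐᵒᵖ (TriangularMatrixRing A B U) :=
      .of_equiv' (M := (TriangularMatrixRing A B U)ᵐᵒᵖ)
        { MulOpposite.opAddEquiv.symm with map_smul' := fun _ _ => rfl }
    .of_projective
  let f : A × U →ₗ[(TriangularMatrixRing A B U)ᵐᵒᵖ] TriangularMatrixRing A B U :=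
    { toFun := fun x => ⟨x.1, x.2, 0⟩
      map_add' := fun _ _ => by ext <;> simp
      map_smul' := fun t x => by
        change (⟨x.1 * t.unop.a, MulOpposite.op t.unop.a • x.2, 0⟩ : TriangularMatrixRing A B U) =
          ⟨x.1, x.2, 0⟩ * t.unop
        ext <;> simp }
  let g : TriangularMatrixRing A B U →ₗ[(TriangularMatrixRing A B U)ᵐᵒᵖ] B :=
    { sndHom A B U with map_smul' := fun t x => rfl }
  refine .right_of_exact (f := f) (g := g) ?_ ?_ sndHom_surjective hAU hT
  · intro x y h
    exact Prod.ext (congrArg a h) (congrArg u h)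
  · intro x
    constructor
    · intro hx
      exact ⟨(x.a, x.u), TriangularMatrixRing.ext rfl rfl (Eq.symm hx)⟩
    · rintro ⟨y, rfl⟩
      rfl

variable (A B U) in
/-- The lower row of a triangular matrix ring is a left ideal with quotient `A`. -/
theorem exists_shortExact : letI := Module.compHom (U × B) (sndHom A B U)
    letI := Module.compHom A (fstHom A B U)
    ∃ (f : U × B →ₗ[TriangularMatrixRing A B U] TriangularMatrixRing A B U)
      (g : TriangularMatrixRing A B U →ₗ[TriangularMatrixRing A B U] A),
      Function.Injective f ∧ Function.Exact f g ∧ Function.Surjective g := by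
  let _ := Module.compHom (U × B) (sndHom A B U)
  let _ := Module.compHom A (fstHom A B U)
  refine ⟨{ toFun := fun x => ⟨0, x.1, x.2⟩, map_add' := ?_, map_smul' := ?_ },
    { fstHom A B U with map_smul' := fun _ _ => rfl }, ?_, ?_, fstHom_surjective⟩
  · intro x y
    ext <;> simp
  · intro t x
    change (⟨0, t.b • x.1, t.b * x.2⟩ : TriangularMatrixRing A B U) = t * ⟨0, x.1, x.2⟩
    ext <;> simp
  · intro x y h
    exact Prod.ext (congrArg u h) (congrArg b h)
  · intro x
    constructor
    · intro hx
      exact ⟨(x.u, x.b), TriangularMatrixRing.ext (Eq.symm hx) rfl rfl⟩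
    · rintro ⟨y, rfl⟩
      rfl

theorem isNoetherianRing_iff [Module.Finite B U] : IsNoetherianRing (TriangularMatrixRing A B U) ↔
    IsNoetherianRing A ∧ IsNoetherianRing B := by
  constructor
  · intro h
    exact ⟨isNoetherianRing_of_surjective _ _ (fstHom A B U) fstHom_surjective,
      isNoetherianRing_of_surjective _ _ (sndHom A B U) sndHom_surjective⟩
  · rintro ⟨_, _⟩
    let _ := Module.compHom (U × B) (sndHom A B U)
    let _ := Module.compHom A (fstHom A B U)
    obtain ⟨f, g, -, hfg, -⟩ := exists_shortExact A B U
    have : IsNoetherian (TriangularMatrixRing A B U) (U × B) :=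
      .of_ringHom _ sndHom_surjective fun _ _ => rfl
    have : IsNoetherian (TriangularMatrixRing A B U) A :=
      .of_ringHom _ fstHom_surjective fun _ _ => rfl
    exact isNoetherian_of_range_eq_ker f g hfg.linearMap_ker_eq.symm

theorem hasFiniteInjectiveDimension (hA : HasFiniteInjectiveDimension A A)
    (hB : HasFiniteInjectiveDimension B B) (hBU : HasFiniteInjectiveDimension B U)
    (hU : HasFiniteProjectiveDimension Aᵐᵒᵖ U) :
    HasFiniteInjectiveDimension (TriangularMatrixRing A B U) (TriangularMatrixRing A B U) := by
  let _ := Module.compHom (U × B) (sndHom A B U)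
  let _ := Module.compHom A (fstHom A B U)
  let _ := (fstHom A B U).rightModule
  let _ := (sndHom A B U).rightModule
  obtain ⟨f, g, hf, hfg, hg⟩ := exists_shortExact A B U
  have := projective_fstHom A B U
  exact .middle_of_exact hf hfg hg
    ((hBU.prod hB).restrictRingHom (sndHom A B U) (fun _ _ => rfl)
      (hasFiniteProjectiveDimension_sndHom hU) fun _ _ => rfl)
    (hA.restrictRingHom (fstHom A B U) (fun _ _ => rfl) .of_projective fun _ _ => rfl)

/-- Over the diagonal subring, `T` splits as `A × U × B` on both sides. The right splitting bounds
projective dimension, which lets the injective dimension of `T` restrict; the left one isolates `A`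
and `B`. -/
theorem hasFiniteInjectiveDimension_diagonal (hU : HasFiniteProjectiveDimension Aᵐᵒᵖ U)
    (h : HasFiniteInjectiveDimension (TriangularMatrixRing A B U) (TriangularMatrixRing A B U)) :
    HasFiniteInjectiveDimension A A ∧ HasFiniteInjectiveDimension B B := by
  let _ := (RingHom.fst A B).rightModule
  let _ := (RingHom.snd A B).rightModule
  let _ := (diagHom A B U).rightModule
  let _ : Module (A × B)ᵐᵒᵖ U := Module.compHom U (RingHom.fst A B).op
  have hA : Module.Projective (A × B)ᵐᵒᵖ A :=
    .rightModule_of_section (RingHom.fst A B) (AddMonoidHom.inl A B) (fun _ => rfl)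
      fun _ _ => by ext <;> simp
  have hB : Module.Projective (A × B)ᵐᵒᵖ B :=
    .rightModule_of_section (RingHom.snd A B) (AddMonoidHom.inr A B) (fun _ => rfl)
      fun _ _ => by ext <;> simp
  have hU' : HasFiniteProjectiveDimension (A × B)ᵐᵒᵖ U :=
    hU.restrictRingHom_op (RingHom.fst A B) hA fun _ _ => rfl
  have hT : HasFiniteProjectiveDimension (A × B)ᵐᵒᵖ (TriangularMatrixRing A B U) := by
    refine .of_retract (N := A × U × B)
      { toFun := fun t => (t.a, t.u, t.b), map_add' := fun _ _ => rfl, map_smul' := ?_ }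
      { toFun := fun x => ⟨x.1, x.2.1, x.2.2⟩, map_add' := fun _ _ => rfl, map_smul' := ?_ }
      (fun _ => rfl)
      (.prod .of_projective (.prod hU' .of_projective))
    · intro x t
      change ((t * diagHom A B U x.unop).a, (t * diagHom A B U x.unop).u,
        (t * diagHom A B U x.unop).b) =
        (t.a * x.unop.1, MulOpposite.op x.unop.1 • t.u, t.b * x.unop.2)
      simp
    · intro x t
      change (⟨t.1 * x.unop.1, MulOpposite.op x.unop.1 • t.2.1, t.2.2 * x.unop.2⟩ :
        TriangularMatrixRing A B U) = ⟨t.1, t.2.1, t.2.2⟩ * diagHom A B U x.unop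
      ext <;> simp
  let _ : Module (A × B) (TriangularMatrixRing A B U) := Module.compHom _ (diagHom A B U)
  let _ : Module (A × B) A := Module.compHom _ (RingHom.fst A B)
  let _ : Module (A × B) B := Module.compHom _ (RingHom.snd A B)
  have hT' : HasFiniteInjectiveDimension (A × B) (TriangularMatrixRing A B U) :=
    h.restrictRingHom (diagHom A B U) (fun _ _ => rfl) hT fun _ _ => rfl
  constructor
  · refine .of_restrictRingHom (RingHom.fst A B) Prod.fst_surjective (fun _ _ => rfl)
      (fun _ _ => rfl) (.of_retract
        { toFun := fun x => ⟨x, 0, 0⟩, map_add' := ?_, map_smul' := ?_ }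
        { toFun := a, map_add' := fun _ _ => rfl, map_smul' := fun _ _ => rfl }
        (fun _ => rfl) hT')
    · intro x y
      ext <;> simp
    · intro t x
      change (⟨t.1 * x, 0, 0⟩ : TriangularMatrixRing A B U) = diagHom A B U t * ⟨x, 0, 0⟩
      ext <;> simp
  · refine .of_restrictRingHom (RingHom.snd A B) Prod.snd_surjective (fun _ _ => rfl)
      (fun _ _ => rfl) (.of_retract
        { toFun := fun x => ⟨0, 0, x⟩, map_add' := ?_, map_smul' := ?_ }
        { toFun := b, map_add' := fun _ _ => rfl, map_smul' := fun _ _ => rfl }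
        (fun _ => rfl) hT')
    · intro x y
      ext <;> simp
    · intro t x
      change (⟨0, 0, t.2 * x⟩ : TriangularMatrixRing A B U) = diagHom A B U t * ⟨0, 0, x⟩
      ext <;> simp

end TriangularMatrixRing

/-! ### One-sided Gorenstein conditions and opposite rings -/

/-- The left-handed half of the Gorenstein condition. -/
structure IsLeftGorensteinRing (R : Type u) [Ring R] : Prop where
  noetherian : IsNoetherianRing R
  injectiveDimension : HasFiniteInjectiveDimension R R

theorem IsLeftGorensteinRing.of_ringEquiv {R S : Type u} [Ring R] [Ring S] (e : R ≃+* S)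
    (h : IsLeftGorensteinRing R) : IsLeftGorensteinRing S where
  noetherian := have := h.noetherian; isNoetherianRing_of_ringEquiv R e
  injectiveDimension := h.injectiveDimension.of_semilinear e e.toAddEquiv (map_mul e)

theorem isGorensteinRing_iff {R : Type u} [Ring R] :
    IsGorensteinRing R ↔ IsLeftGorensteinRing R ∧ IsLeftGorensteinRing Rᵐᵒᵖ := by
  let e : R ≃ₗ[Rᵐᵒᵖ] Rᵐᵒᵖ := { MulOpposite.opAddEquiv with map_smul' := fun _ _ => rfl }
  have hid : HasFiniteInjectiveDimension Rᵐᵒᵖ R ↔ HasFiniteInjectiveDimension Rᵐᵒᵖ Rᵐᵒᵖ :=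
    ⟨.of_retract e.symm.toLinearMap e.toLinearMap fun _ => rfl,
      .of_retract e.toLinearMap e.symm.toLinearMap fun _ => rfl⟩
  have hn : IsNoetherian Rᵐᵒᵖ R ↔ IsNoetherianRing Rᵐᵒᵖ :=
    ⟨fun _ => isNoetherian_of_linearEquiv e, fun _ => isNoetherian_of_linearEquiv e.symm⟩
  constructor
  · rintro ⟨h₁, h₂, h₃, h₄⟩
    exact ⟨⟨h₁, h₃⟩, ⟨hn.1 h₂, hid.1 h₄⟩⟩
  · rintro ⟨⟨h₁, h₃⟩, ⟨h₂, h₄⟩⟩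
    exact ⟨h₁, hn.2 h₂, h₃, hid.2 h₄⟩

namespace TriangularMatrixRing

variable {A B U : Type u} [Ring A] [Ring B] [AddCommGroup U]
  [Module B U] [Module Aᵐᵒᵖ U] [SMulCommClass B Aᵐᵒᵖ U]

theorem isLeftGorensteinRing_iff [Module.Finite B U]
    (hUA : HasFiniteProjectiveDimension Aᵐᵒᵖ U) (hUB : HasFiniteProjectiveDimension B U) :
    IsLeftGorensteinRing (TriangularMatrixRing A B U) ↔
      IsLeftGorensteinRing A ∧ IsLeftGorensteinRing B := by
  constructor
  · rintro ⟨hn, hi⟩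
    obtain ⟨hA, hB⟩ := isNoetherianRing_iff.1 hn
    obtain ⟨hA', hB'⟩ := hasFiniteInjectiveDimension_diagonal hUA hi
    exact ⟨⟨hA, hA'⟩, ⟨hB, hB'⟩⟩
  · rintro ⟨⟨hA, hA'⟩, ⟨hB, hB'⟩⟩
    exact ⟨isNoetherianRing_iff.2 ⟨hA, hB⟩,
      -- Finite generation of `U` over the noetherian ring `B` enters here, to turn projective into
      -- injective dimension.
      hasFiniteInjectiveDimension hA' hB' (hUB.hasFiniteInjectiveDimension hB') hUA⟩

variable (B U) in
/-- The right action of `Bᵐᵒᵖ` corresponding to a left action of `B`. -/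
abbrev moduleOpOp : Module Bᵐᵒᵖᵐᵒᵖ U := Module.compHom U (RingEquiv.opOp B).symm.toRingHom

theorem smulCommClass_moduleOpOp :
    letI := moduleOpOp B U; SMulCommClass Aᵐᵒᵖ Bᵐᵒᵖᵐᵒᵖ U :=
  letI := moduleOpOp B U
  ⟨fun x y z => (smul_comm y.unop.unop x z).symm⟩

variable (A B U) in
/-- The opposite of a triangular matrix ring is a triangular matrix ring. -/
def opEquiv : letI := moduleOpOp B U
    letI : SMulCommClass Aᵐᵒᵖ Bᵐᵒᵖᵐᵒᵖ U := smulCommClass_moduleOpOp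
    (TriangularMatrixRing A B U)ᵐᵒᵖ ≃+* TriangularMatrixRing Bᵐᵒᵖ Aᵐᵒᵖ U :=
  letI := moduleOpOp B U
  letI : SMulCommClass Aᵐᵒᵖ Bᵐᵒᵖᵐᵒᵖ U := smulCommClass_moduleOpOp
  -- Reflection in the antidiagonal: the corners swap and `U` stays in place.
  { toFun := fun t => ⟨.op t.unop.b, t.unop.u, .op t.unop.a⟩
    invFun := fun t => .op ⟨t.b.unop, t.u, t.a.unop⟩
    left_inv := fun _ => rfl
    right_inv := fun _ => rfl
    map_add' := fun _ _ => rfl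
    map_mul' := fun _ _ => TriangularMatrixRing.ext rfl (add_comm _ _) rfl }

/-- The reflection exchanges the roles of `A` and `B`, so finiteness of `U` is now needed over
`Aᵐᵒᵖ`. -/
theorem isLeftGorensteinRing_op_iff [Module.Finite Aᵐᵒᵖ U]
    (hUA : HasFiniteProjectiveDimension Aᵐᵒᵖ U) (hUB : HasFiniteProjectiveDimension B U) :
    IsLeftGorensteinRing (TriangularMatrixRing A B U)ᵐᵒᵖ ↔
      IsLeftGorensteinRing Aᵐᵒᵖ ∧ IsLeftGorensteinRing Bᵐᵒᵖ := by
  let _ := moduleOpOp B U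
  have : SMulCommClass Aᵐᵒᵖ Bᵐᵒᵖᵐᵒᵖ U := smulCommClass_moduleOpOp
  have hUB' : HasFiniteProjectiveDimension Bᵐᵒᵖᵐᵒᵖ U :=
    hUB.of_semilinear (RingEquiv.opOp B) (AddEquiv.refl U) fun _ _ => rfl
  rw [and_comm, ← isLeftGorensteinRing_iff hUB' hUA]
  exact ⟨.of_ringEquiv (opEquiv A B U), .of_ringEquiv (opEquiv A B U).symm⟩

end TriangularMatrixRing

theorem proposition3p2 (A B U : Type u) [Ring A] [Ring B] [AddCommGroup U]
    [Module B U] [Module Aᵐᵒᵖ U] [SMulCommClass B Aᵐᵒᵖ U]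
    (hUA : Module.Finite Aᵐᵒᵖ U) (hBU : Module.Finite B U)
    (hpdA : HasFiniteProjectiveDimension Aᵐᵒᵖ U) (hpdB : HasFiniteProjectiveDimension B U) :
    IsGorensteinRing (TriangularMatrixRing A B U) ↔
      IsGorensteinRing A ∧ IsGorensteinRing B := by
  rw [isGorensteinRing_iff, isGorensteinRing_iff, isGorensteinRing_iff,
    TriangularMatrixRing.isLeftGorensteinRing_iff hpdA hpdB,
    TriangularMatrixRing.isLeftGorensteinRing_op_iff hpdA hpdB]
  exact and_and_and_comm
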